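/- **Theorem 3.2 (quantile fused method: overestimation case).** Fix $p\ge 1$, a quantile level $\tau\in(0,1)$ and integers $K^*\ge 0$ and $K_{max}$, none of them depending on $n$. For each $n$ consider the linear model with change-points $$Y_i=\mathbf{x}_i^\top\boldsymbol\beta^*_i+\varepsilon_i,\qquad i=1,\dots,n,\qquad \mathbf{x}_i=(c^{(0)},x_{2i},\dots,x_{pi})^\top\in\mathbb{R}^p,$$ where $c^{(0)}\neq0$ is a constant and, for large $n$, there are $1=t_0^*<t_1^*<\dots<t^*_{K^*}<t^*_{K^*+1}=n$ with $\boldsymbol\beta_i^*=\boldsymbol\phi^*_{k+1}$ for $t_k^*\le i<t_{k+1}^*$, $k=0,\dots,K^*$, and $\boldsymbol\beta^*_n=\boldsymbol\phi^*_{K^*+1}$ (the design, the $t_k^*$ and the $\boldsymbol\phi_k^*$ may depend on $n$). Let ${\cal A}^*=\{t_1^*,\dots,t_{K^*}^*\}$ and $I^*_{min}=\min_{1\le k\le K^*+1}(t_k^*-t_{k-1}^*)$. Assume: * (A1) there is a constant $0<c^{(1)}<1$ with $\max_{1\le i\le n}\|\mathbf{x}_i\|\le c^{(1)}$ for all $n$;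 * (A2) the errors $\varepsilon_i$ are i.i.d. with a distribution function $F$ such that $F(u)>0$ for all $u\in\mathbb{R}$, with a bounded density, with $\mathbb{P}[\varepsilon<0]=\tau$, and $0$ is their only $\tau$-quantile, i.e. $F(u)\ne\tau$ for $u\neq0$; * (A3) there are constants $0<m_0\le M_0<\infty$ such that, for all large $n$, all eigenvalues of $(n_2-n_1)^{-1}\sum_{i=n_1}^{n_2-1}\mathbf{x}_i\mathbf{x}_i^\top$ lie in $[m_0,M_0]$ whenever $1\le n_1<n_2\le n$ and $n_2-n_1\ge n\delta_n$; * (A4) $I^*_{min}\ge n\delta_n$ for all large $n$, where $(\delta_n)$ is a positive, eventually decreasing sequence with $\delta_n\to0$ and $n\delta_n/\log n\to\infty$; * (A5) there are constants $0<c^{(a)},c^{(b)}<\infty$ with $c^{(b)}<\|\boldsymbol\phi^*_{j+1}-\boldsymbol\phi^*_j\|<c^{(a)}$ for $1\le j\le K^*$ and all large $n$; * (A6) $K^*$ does not depend on $n$; * (A7) $(\lambda_n)$ is a positive sequence with $n\lambda_n\to\infty$ and $\lambda_n/\delta_n\to0$; * (A8) for $k=1,\dots,K^*$ the limit $L_k=\lim_{n\to\infty}(n\delta_n)^{-1}\sum_{i=t_k^*-[n\delta_n]}^{t_k^*-1}F\big(\mathbf{x}_i^\top(\boldsymbol\phi^*_{k+1}-\boldsymbol\phi_k^*)\big)$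 exists and $L_k\ne\tau$. With $\rho_\tau(u)=u(\tau-1_{\{u<0\}})$, let $(\check{\boldsymbol\beta}_1,\dots,\check{\boldsymbol\beta}_n)$ be a quantile fused estimator, that is, a (measurable) minimizer over $(\mathbb{R}^p)^n$ of $$\sum_{i=1}^n\rho_\tau(Y_i-\mathbf{x}_i^\top\boldsymbol\beta_i)+n\lambda_n\sum_{i=2}^n\|\boldsymbol\beta_i-\boldsymbol\beta_{i-1}\|,$$ and let $\check{\cal A}_n=\{i\in\{2,\dots,n\}:\check{\boldsymbol\beta}_i\ne\check{\boldsymbol\beta}_{i-1}\}$ be the set of estimated change-points. Put ${\cal E}(A\|B)=\sup_{b\in B}\inf_{a\in A}|a-b|\in[0,\infty]$. Then $$\lim_{n\to\infty}\mathbb{P}\big[K^*\le|\check{\cal A}_n|\le K_{max}\ \text{ and }\ {\cal E}(\check{\cal A}_n\|{\cal A}^*)>n\delta_n\big]=0 .$$ In particular, if $\mathbb{P}[K^*\le|\check{\cal A}_n|\le K_{max}]\to1$, then $\lim_{n\to\infty}\mathbb{P}\big[{\cal E}(\check{\cal A}_n\|{\cal A}^*)\le n\delta_n\big]=1$. -/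

import Mathlib

open MeasureTheory ProbabilityTheory Filter Topology
open scoped ENNReal

noncomputable section

namespace QuantileFused

/-- The parameter space `ℝ^p` with the Euclidean norm. -/
abbrev Vec (p : ℕ) := EuclideanSpace ℝ (Fin p)

/-- The check function `ρ_τ(u) = u (τ - 1_{u < 0})`. -/
def checkFun (τ u : ℝ) : ℝ := u * (τ - if u < 0 then 1 else 0)

/-- The quantile fused objective function
`R(b) = ∑_{i=1}^n ρ_τ(Y_i - x_iᵀ b_i) + n λ ∑_{i=2}^n ‖b_i - b_{i-1}‖`.
Vectors `(b_1, …, b_n)` are functions on `ℕ` of which only the values at `1, …, n` matter. -/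
def objective {p : ℕ} (n : ℕ) (τ lam : ℝ) (x : ℕ → Vec p) (Y : ℕ → ℝ) (b : ℕ → Vec p) : ℝ :=
  ∑ i ∈ Finset.Icc 1 n, checkFun τ (Y i - inner ℝ (x i) (b i))
    + n * lam * ∑ i ∈ Finset.Icc 2 n, ‖b i - b (i - 1)‖

open Classical in
/-- The set of change locations `{i ∈ {2, …, n} : b_i ≠ b_{i-1}}` of `(b_1, …, b_n)`. -/
def changeSet {p : ℕ} (n : ℕ) (b : ℕ → Vec p) : Finset ℕ :=
  (Finset.Icc 2 n).filter fun i => b i ≠ b (i - 1)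

/-- The set `{t_1, …, t_K}`. -/
def locations (K : ℕ) (t : ℕ → ℕ) : Finset ℕ := (Finset.Icc 1 K).image t

/-- `𝓔(A ‖ B) = sup_{b ∈ B} inf_{a ∈ A} |a - b|`, with values in `[0, ∞]`. -/
def setDev (A B : Finset ℕ) : ℝ≥0∞ :=
  ⨆ b ∈ B, ⨅ a ∈ A, ENNReal.ofReal |(a : ℝ) - (b : ℝ)|

/-- The parameters `b_1, …, b_n` have the phases `[t_k, t_{k+1})`, `k = 0, …, K`, with
`t_0 = 1` and `t_{K+1} = n`, and are equal to `φ_{k+1}` on the phase number `k + 1`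
(the last phase also contains the index `n`). -/
structure HasPhases {p : ℕ} (n K : ℕ) (t : ℕ → ℕ) (φ : ℕ → Vec p) (b : ℕ → Vec p) : Prop where
  first : t 0 = 1
  last : t (K + 1) = n
  lt : ∀ k ≤ K, t k < t (k + 1)
  eq_phase : ∀ k ≤ K, ∀ i, t k ≤ i → i < t (k + 1) → b i = φ (k + 1)
  eq_last : b n = φ (K + 1)

/-- The minimal distance `min_{1 ≤ k ≤ K+1} (t_k - t_{k-1})`. -/
def minGap (K : ℕ) (t : ℕ → ℕ) : ℝ :=
  (Finset.range (K + 1)).inf' Finset.nonempty_range_add_one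
    fun k => (t (k + 1) : ℝ) - (t k : ℝ)

/-- The matrix `(n₂ - n₁)⁻¹ ∑_{i=n₁}^{n₂-1} x_i x_iᵀ`. -/
def gram {p : ℕ} (x : ℕ → Vec p) (n₁ n₂ : ℕ) : Matrix (Fin p) (Fin p) ℝ :=
  ((n₂ : ℝ) - (n₁ : ℝ))⁻¹ • ∑ i ∈ Finset.Ico n₁ n₂, Matrix.vecMulVec (x i) (x i)

/-- The design contains an intercept: the first coordinate of every `x_{n,i}` is a constant
`c₀ ≠ 0`. -/
def HasIntercept {p : ℕ} [NeZero p] (x : ℕ → ℕ → Vec p) : Prop :=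
  ∃ c₀ : ℝ, c₀ ≠ 0 ∧ ∀ n, ∀ i ∈ Finset.Icc 1 n, x n i 0 = c₀

/-- The design is bounded by a constant `0 < c₁ < 1`. -/
def BoundedDesign {p : ℕ} (x : ℕ → ℕ → Vec p) : Prop :=
  ∃ c₁ : ℝ, 0 < c₁ ∧ c₁ < 1 ∧ ∀ n, ∀ i ∈ Finset.Icc 1 n, ‖x n i‖ ≤ c₁

/-- The errors are i.i.d. with law `ν`; the distribution function of `ν` is positive
everywhere, `ν` has a bounded density, and `0` is the `τ`-quantile of `ν`, and the only one. -/
structure ErrorModel {Ω : Type*} [MeasurableSpace Ω] (P : Measure Ω) (ν : Measure ℝ) (τ : ℝ)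
    (ε : ℕ → Ω → ℝ) : Prop where
  measurable : ∀ i, Measurable (ε i)
  indep : iIndepFun ε P
  law : ∀ i, P.map (ε i) = ν
  cdf_pos : ∀ u : ℝ, 0 < cdf ν u
  quantile : ν (Set.Iio 0) = ENNReal.ofReal τ
  quantile_unique : ∀ u : ℝ, cdf ν u = τ → u = 0
  density : ∃ (f : ℝ → ℝ) (M : ℝ), Measurable f ∧ (∀ u, 0 ≤ f u ∧ f u ≤ M) ∧
    ν = volume.withDensity fun u => ENNReal.ofReal (f u)

/-- There are `0 < m₀ ≤ M₀ < ∞` such that, for all large `n`, the eigenvalues of the matrices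
`gram (x n) n₁ n₂` with `1 ≤ n₁ < n₂ ≤ n` and `n₂ - n₁ ≥ n δ_n` lie in `[m₀, M₀]`. -/
def DesignEigenvalues {p : ℕ} (δ : ℕ → ℝ) (x : ℕ → ℕ → Vec p) : Prop :=
  ∃ m₀ M₀ : ℝ, 0 < m₀ ∧ m₀ ≤ M₀ ∧ ∀ᶠ n : ℕ in atTop, ∀ n₁ n₂ : ℕ,
    1 ≤ n₁ → n₁ < n₂ → n₂ ≤ n → n * δ n ≤ (n₂ : ℝ) - (n₁ : ℝ) →
      spectrum ℝ (gram (x n) n₁ n₂) ⊆ Set.Icc m₀ M₀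

/-- The minimal distance is at least `n δ_n` for all large `n`, where `(δ_n)` is positive,
decreasing from some index on, tends to zero, and `n δ_n / log n → ∞`. -/
structure GapCondition (K : ℕ) (t : ℕ → ℕ → ℕ) (δ : ℕ → ℝ) : Prop where
  pos : ∀ n, 0 < δ n
  anti : ∃ N, AntitoneOn δ (Set.Ici N)
  tendsto_zero : Tendsto δ atTop (𝓝 0)
  tendsto_log : Tendsto (fun n : ℕ => n * δ n / Real.log n) atTop atTop
  le_minGap : ∀ᶠ n : ℕ in atTop, n * δ n ≤ minGap K (t n)

/-- The jumps `‖φ_{j+1} - φ_j‖`, `1 ≤ j ≤ K`, lie strictly between two positive constants that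
do not depend on `n`. -/
def JumpSizes {p : ℕ} (K : ℕ) (φ : ℕ → ℕ → Vec p) : Prop :=
  ∃ ca cb : ℝ, 0 < ca ∧ 0 < cb ∧ ∀ᶠ n : ℕ in atTop, ∀ j ∈ Finset.Icc 1 K,
    ‖φ n (j + 1) - φ n j‖ < ca ∧ cb < ‖φ n (j + 1) - φ n j‖

/-- `(λ_n)` is positive, `n λ_n → ∞` and `λ_n / δ_n → 0`. -/
structure TuningCondition (lam δ : ℕ → ℝ) : Prop where
  pos : ∀ n, 0 < lam n
  tendsto_top : Tendsto (fun n : ℕ => n * lam n) atTop atTop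
  tendsto_ratio : Tendsto (fun n => lam n / δ n) atTop (𝓝 0)

/-- For every `k = 1, …, K`, the limit `L_k` of
`(n δ_n)⁻¹ ∑_{i = t_k - [n δ_n]}^{t_k - 1} F(x_iᵀ (φ_{k+1} - φ_k))` exists and `L_k ≠ τ`, where
`F` is the distribution function of `ν`. -/
def Identifiable {p : ℕ} (K : ℕ) (ν : Measure ℝ) (τ : ℝ) (δ : ℕ → ℝ) (x : ℕ → ℕ → Vec p)
    (t : ℕ → ℕ → ℕ) (φ : ℕ → ℕ → Vec p) : Prop :=
  ∀ k ∈ Finset.Icc 1 K, ∃ L : ℝ, τ ≠ L ∧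
    Tendsto (fun n : ℕ => (n * δ n)⁻¹ * ∑ i ∈ Finset.Ico (t n k - ⌊n * δ n⌋₊) (t n k),
      cdf ν (inner ℝ (x n i) (φ n (k + 1) - φ n k))) atTop (𝓝 L)

/-- `bhat n` is a (measurable) quantile fused estimator for every `n`: almost surely, it minimizes
the objective function over all parameter vectors. -/
structure IsFusedEstimator {Ω : Type*} [MeasurableSpace Ω] (P : Measure Ω) {p : ℕ} (τ : ℝ)
    (lam : ℕ → ℝ) (x : ℕ → ℕ → Vec p) (Y : ℕ → ℕ → Ω → ℝ) (bhat : ℕ → Ω → ℕ → Vec p) :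
    Prop where
  measurable : ∀ n i, Measurable fun ω => bhat n ω i
  isMin : ∀ n, ∀ᵐ ω ∂P, ∀ b : ℕ → Vec p,
    objective n τ (lam n) (x n) (fun i => Y n i ω) (bhat n ω) ≤
      objective n τ (lam n) (x n) (fun i => Y n i ω) b

end QuantileFused

end

namespace QuantileFused

/-! Suppose no estimated change lies within `n δ_n` of a true change-point. With `m = ⌈n δ_n⌉`, the
estimator equals one vector `c` on the `m` indices before it and the `m` from it on, where the truth
is `φ_k` and `φ_{k+1}`. Replacing `c` by the truth on either half costs at most `2 n λ_n ‖c - φ‖` in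
penalty, so by minimality the excess loss at `c - φ` is at most that (`sum_checkFun_le_of_isMin`).
With probability tending to one, the excess loss on a sphere of fixed radius `r` is of order `m`,
which dominates `n λ_n` (`ErrorModel.exists_measure_excessLoss_le`). Convexity then forces `‖c - φ‖
< r` on both halves (`norm_lt_of_excessLoss_le`), impossible when the jump is at least `2r`. A union
bound over the fixed number of change-points finishes. -/

/-! ### Check function: convexity and Lipschitz bounds. -/

theorem measurable_checkFun (τ : ℝ) : Measurable (checkFun τ) := by
  unfold checkFun
  exact measurable_id.mul (measurable_const.sub
    (Measurable.ite measurableSet_Iio measurable_const measurable_const))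

/-- The subgradient inequality for the check function. -/
theorem checkFun_add_mul_le (τ e v w : ℝ) :
    checkFun τ (e - v) + (w - v) * ((if e < v then 1 else 0) - τ) ≤ checkFun τ (e - w) := by
  unfold checkFun
  simp only [sub_neg]
  split_ifs <;> nlinarith

/-- The subgradients used are `-τ` and `1 - τ`, both of modulus below one. -/
theorem abs_checkFun_sub_le {τ : ℝ} (hτ : 0 < τ ∧ τ < 1) (a b : ℝ) :
    |checkFun τ a - checkFun τ b| ≤ |a - b| := by
  have key : ∀ u v : ℝ, checkFun τ u - checkFun τ v ≤ |u - v| := by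
    intro u v
    have h := checkFun_add_mul_le τ 0 (-u) (-v)
    simp only [zero_sub, neg_neg] at h
    have h1 := le_abs_self (u - v)
    have h2 := neg_abs_le (u - v)
    have h3 := abs_nonneg (u - v)
    split_ifs at h <;> nlinarith [hτ.1, hτ.2]
  refine abs_sub_le_iff.mpr ⟨key a b, ?_⟩
  rw [abs_sub_comm]
  exact key b a

/-- Convexity along the segment from `0` to `v`: the subgradient inequalities at `s * v` towards
both ends, averaged with weights `s` and `1 - s`. -/
theorem checkFun_sub_mul_le (τ e v : ℝ) {s : ℝ} (hs : 0 ≤ s) (hs1 : s ≤ 1) :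
    checkFun τ (e - s * v) - checkFun τ e ≤ s * (checkFun τ (e - v) - checkFun τ e) := by
  have h1 := checkFun_add_mul_le τ e (s * v) v
  have h2 := checkFun_add_mul_le τ e (s * v) 0
  rw [sub_zero] at h2
  nlinarith [mul_le_mul_of_nonneg_left h1 hs, mul_le_mul_of_nonneg_left h2 (sub_nonneg.mpr hs1)]

/-- The bound is free of `e`, so excess losses have all moments even if the errors have none. -/
theorem abs_checkFun_sub_self_le {τ : ℝ} (hτ : 0 < τ ∧ τ < 1) (e v : ℝ) :
    |checkFun τ (e - v) - checkFun τ e| ≤ |v| := by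
  have := abs_checkFun_sub_le hτ (e - v) e
  rwa [sub_sub_cancel_left, abs_neg] at this

theorem measurable_checkFun_sub (τ v : ℝ) :
    Measurable fun e => checkFun τ (e - v) - checkFun τ e :=
  ((measurable_checkFun τ).comp (measurable_id.sub_const v)).sub (measurable_checkFun τ)

theorem integrable_checkFun_sub {τ : ℝ} (hτ : 0 < τ ∧ τ < 1) (ν : Measure ℝ)
    [IsFiniteMeasure ν] (v : ℝ) :
    Integrable (fun e => checkFun τ (e - v) - checkFun τ e) ν :=
  Integrable.of_bound (measurable_checkFun_sub τ v).aestronglyMeasurable |v|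
    (ae_of_all _ fun e => abs_checkFun_sub_self_le hτ e v)

/-! ### Population excess risk. -/

/-- Lower bound for the excess risk of the shift `v` through the probabilities of two half-lines. -/
theorem half_mul_add_le_integral_checkFun_sub {τ : ℝ} (hτ : 0 < τ ∧ τ < 1) (ν : Measure ℝ)
    [IsProbabilityMeasure ν] (v : ℝ) :
    v / 2 * (ν.real (Set.Iio (v / 2)) - τ) + v / 2 * (ν.real (Set.Iio 0) - τ)
      ≤ ∫ e, (checkFun τ (e - v) - checkFun τ e) ∂ν := by
  have hint : ∀ a : ℝ, Integrable ((Set.Iio a).indicator (fun _ : ℝ => (1 : ℝ))) ν := fun a =>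
    (integrable_const 1).indicator measurableSet_Iio
  have hval : ∀ a : ℝ, ∫ e, (v / 2 * ((Set.Iio a).indicator (fun _ : ℝ => (1 : ℝ)) e - τ)) ∂ν
      = v / 2 * (ν.real (Set.Iio a) - τ) := by
    intro a
    rw [integral_const_mul, integral_sub (hint a) (integrable_const τ),
      integral_indicator measurableSet_Iio]
    simp
  have hi : ∀ a : ℝ,
      Integrable (fun e => v / 2 * ((Set.Iio a).indicator (fun _ : ℝ => (1 : ℝ)) e - τ)) ν :=
    fun a => ((hint a).sub (integrable_const τ)).const_mul _
  rw [← hval, ← hval, ← integral_add (hi _) (hi _)]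
  refine integral_mono ((hi _).add (hi _)) (integrable_checkFun_sub hτ ν v) fun e => ?_
  -- The path from `0` to `v` is cut at `v / 2`; the two subgradient inequalities telescope.
  have h1 := checkFun_add_mul_le τ e (v / 2) v
  have h2 := checkFun_add_mul_le τ e 0 (v / 2)
  simp only [Set.indicator_apply, Set.mem_Iio]
  rw [sub_zero] at h2
  rw [show v - v / 2 = v / 2 by ring] at h1
  linarith

/-- The excess risk grows at least linearly away from the unique `τ`-quantile `0`. -/
theorem exists_mul_abs_le_integral_checkFun_sub {τ : ℝ} (hτ : 0 < τ ∧ τ < 1) (ν : Measure ℝ)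
    [IsProbabilityMeasure ν] (hq : ν (Set.Iio 0) = ENNReal.ofReal τ)
    (hu : ∀ u : ℝ, cdf ν u = τ → u = 0) {η : ℝ} (hη : 0 < η) :
    ∃ κ : ℝ, 0 < κ ∧ (∀ v : ℝ, η ≤ |v| →
        κ * |v| ≤ ∫ e, (checkFun τ (e - v) - checkFun τ e) ∂ν) ∧
      ∀ v : ℝ, 0 ≤ ∫ e, (checkFun τ (e - v) - checkFun τ e) ∂ν := by
  have h0 : ν.real (Set.Iio 0) = τ := by
    rw [measureReal_def, hq, ENNReal.toReal_ofReal hτ.1.le]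
  -- Uniqueness of the quantile makes this strict. Since `|v / 2| ≥ η / 2 > η / 4`, there is room to
  -- pass between open and closed half-lines.
  have hpos : τ < cdf ν (η / 4) := by
    refine lt_of_le_of_ne ?_ fun h => by linarith [hu _ h.symm]
    rw [cdf_eq_real, ← h0]
    exact measureReal_mono (Set.Iio_subset_Iic_self.trans (Set.Iic_subset_Iic.mpr (by linarith)))
  have hneg : cdf ν (-(η / 4)) < τ := by
    refine lt_of_le_of_ne ?_ fun h => by linarith [hu _ h]
    rw [cdf_eq_real, ← h0]
    exact measureReal_mono (Set.Iic_subset_Iio.mpr (by linarith))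
  rw [cdf_eq_real] at hpos hneg
  refine ⟨min ((ν.real (Set.Iic (η / 4)) - τ) / 2) ((τ - ν.real (Set.Iic (-(η / 4)))) / 2),
    lt_min (by linarith) (by linarith), fun v hv => ?_, fun v => ?_⟩
  · refine le_trans ?_ (half_mul_add_le_integral_checkFun_sub hτ ν v)
    rw [h0, sub_self, mul_zero, add_zero]
    rcases le_total 0 v with hv0 | hv0
    · rw [abs_of_nonneg hv0] at hv ⊢
      have h1 : ν.real (Set.Iic (η / 4)) ≤ ν.real (Set.Iio (v / 2)) :=
        measureReal_mono (Set.Iic_subset_Iio.mpr (by linarith))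
      have h2 := mul_le_mul_of_nonneg_right (min_le_left ((ν.real (Set.Iic (η / 4)) - τ) / 2)
        ((τ - ν.real (Set.Iic (-(η / 4)))) / 2)) hv0
      nlinarith
    · rw [abs_of_nonpos hv0] at hv ⊢
      have h1 : ν.real (Set.Iio (v / 2)) ≤ ν.real (Set.Iic (-(η / 4))) :=
        measureReal_mono (Set.Iio_subset_Iic_self.trans (Set.Iic_subset_Iic.mpr (by linarith)))
      have h2 := mul_le_mul_of_nonneg_right (min_le_right ((ν.real (Set.Iic (η / 4)) - τ) / 2)
        ((τ - ν.real (Set.Iic (-(η / 4)))) / 2)) (neg_nonneg.mpr hv0)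
      nlinarith
  · refine le_trans ?_ (half_mul_add_le_integral_checkFun_sub hτ ν v)
    rw [h0, sub_self, mul_zero, add_zero]
    rcases le_total 0 v with hv0 | hv0
    · have h1 : ν.real (Set.Iio 0) ≤ ν.real (Set.Iio (v / 2)) :=
        measureReal_mono (Set.Iio_subset_Iio (by linarith))
      nlinarith
    · have h1 : ν.real (Set.Iio (v / 2)) ≤ ν.real (Set.Iio 0) :=
        measureReal_mono (Set.Iio_subset_Iio (by linarith))
      nlinarith

/-! ### Design and block excess loss. -/

/-- A lower bound for the spectrum of `gram x l u` bounds its quadratic form from below. -/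
theorem mul_sq_norm_le_sum_inner_sq {p : ℕ} {x : ℕ → Vec p} {l u : ℕ} (hlu : l < u) {m₀ M₀ : ℝ}
    (hspec : spectrum ℝ (gram x l u) ⊆ Set.Icc m₀ M₀) (h : Vec p) :
    m₀ * ‖h‖ ^ 2 * ((u : ℝ) - l) ≤ ∑ i ∈ Finset.Ico l u, (inner ℝ (x i) h) ^ 2 := by
  have hpos : (0 : ℝ) < (u : ℝ) - l := by
    rw [sub_pos]; exact_mod_cast hlu
  have hherm : (gram x l u - algebraMap ℝ (Matrix (Fin p) (Fin p) ℝ) m₀).IsHermitian := by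
    have h1 : (gram x l u).IsHermitian := by
      unfold gram Matrix.IsHermitian
      ext a b
      simp [Matrix.conjTranspose_apply, Matrix.sum_apply, Matrix.vecMulVec_apply, mul_comm]
    refine h1.sub ?_
    rw [Algebra.algebraMap_eq_smul_one]
    ext a b
    simp [Matrix.one_apply, eq_comm]
  have hpsd : (gram x l u - algebraMap ℝ (Matrix (Fin p) (Fin p) ℝ) m₀).PosSemidef := by
    rw [Matrix.posSemidef_iff_isHermitian_and_spectrum_nonneg]
    refine ⟨hherm, ?_⟩
    rw [← spectrum.sub_singleton_eq]
    rintro _ ⟨y, hy, z, rfl, rfl⟩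
    exact sub_nonneg.mpr (hspec hy).1
  have hq := hpsd.dotProduct_mulVec_nonneg (WithLp.ofLp h)
  have hn : ‖h‖ ^ 2 = WithLp.ofLp h ⬝ᵥ WithLp.ofLp h := by
    rw [EuclideanSpace.real_norm_sq_eq]
    simp [dotProduct, sq]
  have hi : ∀ i, inner ℝ (x i) h = WithLp.ofLp (x i) ⬝ᵥ WithLp.ofLp h := by
    intro i
    rw [EuclideanSpace.inner_eq_star_dotProduct, dotProduct_comm]
    simp
  rw [Matrix.sub_mulVec, Algebra.algebraMap_eq_smul_one, Matrix.smul_mulVec, Matrix.one_mulVec,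
    dotProduct_sub, dotProduct_smul, star_trivial, ← hn, gram, Matrix.smul_mulVec,
    dotProduct_smul, Matrix.sum_mulVec, dotProduct_sum, sub_nonneg, smul_eq_mul, smul_eq_mul,
    le_inv_mul_iff₀ hpos] at hq
  refine (le_of_eq (by ring)).trans (hq.trans (le_of_eq (Finset.sum_congr rfl fun i _ => ?_)))
  rw [hi, Matrix.vecMulVec_mulVec]
  simp [dotProduct_comm, sq]

/-- The loss on the block `[l, u)` at the true parameter plus `h`, minus the loss at the true
parameter, as a function of the errors `e`. -/
noncomputable def excessLoss {p : ℕ} (τ : ℝ) (x : ℕ → Vec p) (e : ℕ → ℝ) (l u : ℕ) (h : Vec p) :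
    ℝ :=
  ∑ i ∈ Finset.Ico l u, (checkFun τ (e i - inner ℝ (x i) h) - checkFun τ (e i))

theorem excessLoss_smul_le {p : ℕ} (τ : ℝ) (x : ℕ → Vec p) (e : ℕ → ℝ) (l u : ℕ) (h : Vec p)
    {s : ℝ} (hs : 0 ≤ s) (hs1 : s ≤ 1) :
    excessLoss τ x e l u (s • h) ≤ s * excessLoss τ x e l u h := by
  unfold excessLoss
  rw [Finset.mul_sum]
  refine Finset.sum_le_sum fun i _ => ?_
  rw [real_inner_smul_right]
  exact checkFun_sub_mul_le τ _ _ hs hs1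

/-- A Lipschitz bound of the order of the block length, which carries estimates from a finite net to
the whole sphere. -/
theorem excessLoss_sub_le {p : ℕ} {τ : ℝ} (hτ : 0 < τ ∧ τ < 1) {x : ℕ → Vec p} (e : ℕ → ℝ)
    {l u : ℕ} (hlu : l ≤ u) (hx : ∀ i ∈ Finset.Ico l u, ‖x i‖ ≤ 1) (h h' : Vec p) :
    excessLoss τ x e l u h - excessLoss τ x e l u h' ≤ ((u : ℝ) - l) * ‖h - h'‖ := by
  unfold excessLoss
  rw [← Finset.sum_sub_distrib]
  refine (Finset.sum_le_card_nsmul _ _ ‖h - h'‖ fun i hi => ?_).trans_eq ?_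
  · rw [sub_sub_sub_cancel_right]
    refine (le_abs_self _).trans ((abs_checkFun_sub_le hτ _ _).trans ?_)
    rw [sub_sub_sub_cancel_left, ← inner_sub_right, norm_sub_rev]
    refine (abs_real_inner_le_norm _ _).trans ?_
    exact mul_le_of_le_one_left (norm_nonneg _) (hx i hi)
  · rw [Nat.card_Ico, nsmul_eq_mul, Nat.cast_sub hlu]

/-- If the excess loss is large on the sphere of radius `r`, then a point where it is small
lies in the ball of radius `r`. -/
theorem norm_lt_of_excessLoss_le {p : ℕ} {τ : ℝ} {x : ℕ → Vec p} {e : ℕ → ℝ} {l u : ℕ} {r q : ℝ}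
    (hr : 0 < r) (hsphere : ∀ h : Vec p, ‖h‖ = r → q * r < excessLoss τ x e l u h) {h : Vec p}
    (hh : excessLoss τ x e l u h ≤ q * ‖h‖) : ‖h‖ < r := by
  by_contra! hle
  have hpos : 0 < ‖h‖ := hr.trans_le hle
  -- Shrink `h` radially onto the sphere; by convexity the excess loss shrinks at least as fast.
  have h1 := hsphere ((r / ‖h‖) • h) (by
    rw [norm_smul, Real.norm_of_nonneg (by positivity), div_mul_cancel₀ _ hpos.ne'])
  have h2 := excessLoss_smul_le τ x e l u h (div_nonneg hr.le hpos.le) ((div_le_one hpos).mpr hle)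
  have h3 := mul_le_mul_of_nonneg_left hh (div_nonneg hr.le hpos.le)
  have h4 : r / ‖h‖ * (q * ‖h‖) = q * r := by field_simp
  linarith

/-! ### Consequences of minimality. -/

/-- Changing a minimizer by `d` on a block cannot decrease the loss there by more than the
increase `2 n λ ‖d‖` of the penalty. -/
theorem sum_checkFun_le_of_isMin {p : ℕ} {n : ℕ} {τ lam : ℝ} (hlam : 0 ≤ lam) {x : ℕ → Vec p}
    {Y : ℕ → ℝ} {b : ℕ → Vec p} (hmin : ∀ b', objective n τ lam x Y b ≤ objective n τ lam x Y b')
    {l u : ℕ} (hl : 1 ≤ l) (hu : u ≤ n + 1) (d : Vec p) :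
    ∑ i ∈ Finset.Ico l u, checkFun τ (Y i - inner ℝ (x i) (b i)) ≤
      ∑ i ∈ Finset.Ico l u, checkFun τ (Y i - inner ℝ (x i) (b i + d)) + 2 * (n * lam) * ‖d‖ := by
  classical
  set b' : ℕ → Vec p := fun i => if i ∈ Finset.Ico l u then b i + d else b i with hb'
  have h1 := hmin b'
  have hsub : Finset.Ico l u ⊆ Finset.Icc 1 n := by
    intro i hi
    rw [Finset.mem_Ico] at hi
    rw [Finset.mem_Icc]
    omega
  have hloss : ∀ c : ℕ → Vec p, ∑ i ∈ Finset.Icc 1 n, checkFun τ (Y i - inner ℝ (x i) (c i)) =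
      ∑ i ∈ Finset.Icc 1 n \ Finset.Ico l u, checkFun τ (Y i - inner ℝ (x i) (c i)) +
      ∑ i ∈ Finset.Ico l u, checkFun τ (Y i - inner ℝ (x i) (c i)) :=
    fun c => (Finset.sum_sdiff hsub).symm
  have hout : ∑ i ∈ Finset.Icc 1 n \ Finset.Ico l u, checkFun τ (Y i - inner ℝ (x i) (b' i)) =
      ∑ i ∈ Finset.Icc 1 n \ Finset.Ico l u, checkFun τ (Y i - inner ℝ (x i) (b i)) :=
    Finset.sum_congr rfl fun i hi => by
      rw [hb']; simp only; rw [if_neg (Finset.mem_sdiff.mp hi).2]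
  have hin : ∑ i ∈ Finset.Ico l u, checkFun τ (Y i - inner ℝ (x i) (b' i)) =
      ∑ i ∈ Finset.Ico l u, checkFun τ (Y i - inner ℝ (x i) (b i + d)) :=
    Finset.sum_congr rfl fun i hi => by rw [hb']; simp only; rw [if_pos hi]
  have hpen : ∑ i ∈ Finset.Icc 2 n, ‖b' i - b' (i - 1)‖ ≤
      ∑ i ∈ Finset.Icc 2 n, ‖b i - b (i - 1)‖ + 2 * ‖d‖ := by
    -- Only the increments at the two ends `l` and `u` of the block change; an end outside `{2, …,
    -- n}` costs nothing.
    have hterm : ∀ i ∈ Finset.Icc 2 n, ‖b' i - b' (i - 1)‖ ≤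
        ‖b i - b (i - 1)‖ + ((if i = l then ‖d‖ else 0) + (if i = u then ‖d‖ else 0)) := by
      intro i hi
      have hi2 := (Finset.mem_Icc.mp hi).1
      have hplus : ‖b i + d - b (i - 1)‖ ≤ ‖b i - b (i - 1)‖ + ‖d‖ := by
        rw [add_sub_right_comm]; exact norm_add_le _ _
      have hminus : ‖b i - (b (i - 1) + d)‖ ≤ ‖b i - b (i - 1)‖ + ‖d‖ := by
        rw [← sub_sub]; exact norm_sub_le _ _
      have hd := norm_nonneg d
      simp only [hb', Finset.mem_Ico]
      by_cases c1 : l ≤ i ∧ i < u <;> by_cases c2 : l ≤ i - 1 ∧ i - 1 < u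
      · rw [if_pos c1, if_pos c2, add_sub_add_right_eq_sub]
        have : 0 ≤ (if i = l then ‖d‖ else 0) + (if i = u then ‖d‖ else 0) := by positivity
        linarith
      · rw [if_pos c1, if_neg c2, if_pos (by omega : i = l)]
        split_ifs <;> linarith
      · rw [if_neg c1, if_pos c2, if_pos (by omega : i = u)]
        split_ifs <;> linarith
      · rw [if_neg c1, if_neg c2]
        have : 0 ≤ (if i = l then ‖d‖ else 0) + (if i = u then ‖d‖ else 0) := by positivity
        linarith
    refine (Finset.sum_le_sum hterm).trans ?_
    rw [Finset.sum_add_distrib, Finset.sum_add_distrib, Finset.sum_ite_eq', Finset.sum_ite_eq']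
    have hd := norm_nonneg d
    split_ifs <;> linarith
  unfold objective at h1
  rw [hloss b, hloss b', hout, hin] at h1
  have h2 := mul_le_mul_of_nonneg_left hpen (mul_nonneg n.cast_nonneg hlam : (0 : ℝ) ≤ n * lam)
  linarith

/-- On a block where both the true parameter and the minimizer are constant, the estimation error
is smaller than `r` as soon as the excess loss is large on the sphere of radius `r`. -/
theorem norm_sub_lt_of_isMin {p : ℕ} {n : ℕ} {τ lam : ℝ} (hlam : 0 ≤ lam) {x : ℕ → Vec p}
    {β : ℕ → Vec p} {e : ℕ → ℝ} {b : ℕ → Vec p}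
    (hmin : ∀ b', objective n τ lam x (fun i => inner ℝ (x i) (β i) + e i) b ≤
      objective n τ lam x (fun i => inner ℝ (x i) (β i) + e i) b')
    {l u : ℕ} (hl : 1 ≤ l) (hu : u ≤ n + 1) {φ c : Vec p}
    (hβ : ∀ i ∈ Finset.Ico l u, β i = φ) (hb : ∀ i ∈ Finset.Ico l u, b i = c) {r : ℝ} (hr : 0 < r)
    (hsphere : ∀ h : Vec p, ‖h‖ = r → 2 * (n * lam) * r < excessLoss τ x e l u h) :
    ‖c - φ‖ < r := by
  refine norm_lt_of_excessLoss_le hr hsphere ?_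
  -- This shift moves the block onto the truth, leaving pure noise in the comparison loss.
  have h1 := sum_checkFun_le_of_isMin hlam hmin hl hu (φ - c)
  have h2 : ∑ i ∈ Finset.Ico l u, checkFun τ (inner ℝ (x i) (β i) + e i - inner ℝ (x i) (b i)) =
      ∑ i ∈ Finset.Ico l u, checkFun τ (e i - inner ℝ (x i) (c - φ)) :=
    Finset.sum_congr rfl fun i hi => by
      rw [hβ i hi, hb i hi, inner_sub_right]; congr 1; ring
  have h3 : ∑ i ∈ Finset.Ico l u,
        checkFun τ (inner ℝ (x i) (β i) + e i - inner ℝ (x i) (b i + (φ - c))) =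
      ∑ i ∈ Finset.Ico l u, checkFun τ (e i) :=
    Finset.sum_congr rfl fun i hi => by
      rw [hβ i hi, hb i hi, add_sub_cancel]; congr 1; ring
  rw [h2, h3, norm_sub_rev] at h1
  unfold excessLoss
  rw [Finset.sum_sub_distrib]
  linarith

/-! ### Uniform lower bound on a sphere. -/

/-- Chebyshev's inequality for the lower tail of a sum of independent bounded variables. -/
theorem measure_sum_le_of_bounded {Ω : Type*} [MeasurableSpace Ω] {P : Measure Ω}
    [IsProbabilityMeasure P] {Z : ℕ → Ω → ℝ} (hZ : ∀ i, Measurable (Z i))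
    (hind : iIndepFun Z P) (s : Finset ℕ) {r : ℝ} (hr : ∀ i ∈ s, ∀ ω, |Z i ω| ≤ r) {m a : ℝ}
    (hm : m ≤ ∑ i ∈ s, ∫ ω, Z i ω ∂P) (ha : 0 < a) :
    P {ω | ∑ i ∈ s, Z i ω ≤ m - a} ≤ ENNReal.ofReal (s.card * r ^ 2 / a ^ 2) := by
  have hL : ∀ i ∈ s, MemLp (Z i) 2 P := fun i hi =>
    MemLp.of_bound (hZ i).aestronglyMeasurable r (ae_of_all _ fun ω => hr i hi ω)
  have hcheb := meas_ge_le_variance_div_sq (memLp_finsetSum' s hL) ha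
  have hvar : Var[∑ i ∈ s, Z i; P] ≤ s.card * r ^ 2 := by
    rw [IndepFun.variance_sum hL fun i _ j _ hij => hind.indepFun hij, ← nsmul_eq_mul]
    refine Finset.sum_le_card_nsmul _ _ _ fun i hi => ?_
    have := variance_le_sq_of_bounded (μ := P) (X := Z i) (a := -r) (b := r)
      (ae_of_all _ fun ω => abs_le.mp (hr i hi ω)) (hZ i).aemeasurable
    refine this.trans_eq (by ring)
  refine (measure_mono fun ω hω => ?_).trans
    (hcheb.trans (ENNReal.ofReal_le_ofReal (by gcongr)))
  have hE : ∫ ω, (∑ i ∈ s, Z i) ω ∂P = ∑ i ∈ s, ∫ ω, Z i ω ∂P := by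
    simp only [Finset.sum_apply]
    exact integral_finsetSum s fun i hi => (hL i hi).integrable (by norm_num)
  simp only [Set.mem_ofPred_eq] at hω ⊢
  rw [hE, Finset.sum_apply, abs_sub_comm]
  refine le_trans ?_ (le_abs_self _)
  linarith

/-- The excess loss exceeds a fixed multiple of the length of the block on the sphere of radius
`r`, with probability tending to one uniformly in the design and the block. -/
theorem ErrorModel.exists_measure_excessLoss_le {Ω : Type*} [MeasurableSpace Ω] {P : Measure Ω}
    [IsProbabilityMeasure P] {ν : Measure ℝ} {τ : ℝ} {ε : ℕ → Ω → ℝ} (hε : ErrorModel P ν τ ε)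
    (hτ : 0 < τ ∧ τ < 1) (p : ℕ) {m₀ r : ℝ} (hm₀ : 0 < m₀) (hr : 0 < r) :
    ∃ c C : ℝ, 0 < c ∧ ∀ (x : ℕ → Vec p) (l u : ℕ) (q : ℝ), l < u →
      (∀ i ∈ Finset.Ico l u, ‖x i‖ ≤ 1) →
      (∀ h : Vec p, m₀ * ‖h‖ ^ 2 * ((u : ℝ) - l) ≤ ∑ i ∈ Finset.Ico l u, (inner ℝ (x i) h) ^ 2) →
      q ≤ c * ((u : ℝ) - l) →
      P {ω | ¬ ∀ h : Vec p, ‖h‖ = r → q * r < excessLoss τ x (fun i => ε i ω) l u h} ≤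
        ENNReal.ofReal (C / ((u : ℝ) - l)) := by
  have hν : IsProbabilityMeasure ν := by
    rw [← hε.law 0]
    exact Measure.isProbabilityMeasure_map (hε.measurable 0).aemeasurable
  have hη : 0 < r * √(m₀ / 2) := by positivity
  obtain ⟨κ, hκ, hfar, hall⟩ :=
    exists_mul_abs_le_integral_checkFun_sub hτ ν hε.quantile hε.quantile_unique hη
  set a : ℝ := κ * (m₀ * r) / 8 with ha
  have ha0 : 0 < a := by positivity
  -- Budget per observation: the mean is at least `4a`, Chebyshev spends `a`, the net of mesh `a`
  -- spends another, and the remaining `2a` covers `q * r`.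
  obtain ⟨T, hTs, hTfin, hTcov⟩ :=
    (isCompact_sphere (0 : Vec p) r).finite_cover_balls ha0
  refine ⟨κ * m₀ / 4, (hTfin.toFinset.card : ℝ) * (r ^ 2 / a ^ 2), by positivity, ?_⟩
  intro x l u q hlu hx hquad hq
  have hN : (0 : ℝ) < (u : ℝ) - l := by
    rw [sub_pos]; exact_mod_cast hlu
  have hmean : ∀ h : Vec p, ‖h‖ = r → 4 * a * ((u : ℝ) - l) ≤
      ∑ i ∈ Finset.Ico l u, ∫ e, (checkFun τ (e - inner ℝ (x i) h) - checkFun τ e) ∂ν := by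
    intro h hh
    -- A quadratic minorant that the Gram bound can sum. Beyond the threshold, `|v| ≤ r` gives `κ
    -- |v| ≥ κ v² / r`; below it the left side is nonpositive. The threshold gives away half of the
    -- Gram bound.
    have hterm : ∀ i ∈ Finset.Ico l u, κ / r * ((inner ℝ (x i) h) ^ 2 - r ^ 2 * (m₀ / 2)) ≤
        ∫ e, (checkFun τ (e - inner ℝ (x i) h) - checkFun τ e) ∂ν := by
      intro i hi
      set v : ℝ := inner ℝ (x i) h
      have hsq : (r * √(m₀ / 2)) ^ 2 = r ^ 2 * (m₀ / 2) := by
        rw [mul_pow, Real.sq_sqrt (by positivity)]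
      rcases le_or_gt (r * √(m₀ / 2)) |v| with hv | hv
      · refine le_trans ?_ (hfar v hv)
        have hvr : |v| ≤ r := by
          refine (abs_real_inner_le_norm _ _).trans ?_
          rw [hh]
          exact mul_le_of_le_one_left hr.le (hx i hi)
        rw [div_mul_eq_mul_div, div_le_iff₀ hr, mul_assoc]
        refine mul_le_mul_of_nonneg_left ?_ hκ.le
        rw [← sq_abs v]
        nlinarith [abs_nonneg v, mul_pos (pow_pos hr 2) (half_pos hm₀)]
      · refine le_trans ?_ (hall v)
        refine mul_nonpos_of_nonneg_of_nonpos (by positivity) ?_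
        rw [← hsq, ← sq_abs v]
        have := pow_le_pow_left₀ (abs_nonneg v) hv.le 2
        linarith
    refine le_trans ?_ (Finset.sum_le_sum hterm)
    rw [← Finset.mul_sum, Finset.sum_sub_distrib, Finset.sum_const, Nat.card_Ico, nsmul_eq_mul,
      Nat.cast_sub hlu.le]
    have h1 := hquad h
    rw [hh] at h1
    have h2 : 4 * a * ((u : ℝ) - l) =
        κ / r * (m₀ * r ^ 2 * ((u : ℝ) - l) - ((u : ℝ) - l) * (r ^ 2 * (m₀ / 2))) := by
      rw [ha]; field_simp; ring
    rw [h2]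
    gcongr
  have hpoint : ∀ h ∈ T, P {ω | excessLoss τ x (fun i => ε i ω) l u h ≤ 3 * a * ((u : ℝ) - l)} ≤
      ENNReal.ofReal (r ^ 2 / a ^ 2 / ((u : ℝ) - l)) := by
    intro h hT
    have hh : ‖h‖ = r := mem_sphere_zero_iff_norm.mp (hTs hT)
    have hg : ∀ i, Measurable fun e => checkFun τ (e - inner ℝ (x i) h) - checkFun τ e :=
      fun i => measurable_checkFun_sub τ _
    have h1 := measure_sum_le_of_bounded (P := P)
      (Z := fun i => (fun e => checkFun τ (e - inner ℝ (x i) h) - checkFun τ e) ∘ ε i)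
      (fun i => (hg i).comp (hε.measurable i))
      (hε.indep.comp (fun i e => checkFun τ (e - inner ℝ (x i) h) - checkFun τ e) hg)
      (Finset.Ico l u) (r := r)
      (fun i hi ω => (abs_checkFun_sub_self_le hτ _ _).trans
        ((abs_real_inner_le_norm _ _).trans (by
          rw [hh]; exact mul_le_of_le_one_left hr.le (hx i hi))))
      (m := 4 * a * ((u : ℝ) - l)) (a := a * ((u : ℝ) - l))
      ((hmean h hh).trans_eq (Finset.sum_congr rfl fun i _ => by
        rw [← hε.law i, integral_map (hε.measurable i).aemeasurable
          (hg i).aestronglyMeasurable]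
        rfl)) (by positivity)
    refine (measure_mono fun ω hω => ?_).trans (h1.trans_eq ?_)
    · simp only [Set.mem_ofPred_eq, Function.comp] at hω ⊢
      unfold excessLoss at hω
      linarith
    · rw [Nat.card_Ico, Nat.cast_sub hlu.le]
      congr 1
      field_simp
  calc P {ω | ¬ ∀ h : Vec p, ‖h‖ = r → q * r < excessLoss τ x (fun i => ε i ω) l u h}
      ≤ P (⋃ h ∈ hTfin.toFinset,
          {ω | excessLoss τ x (fun i => ε i ω) l u h ≤ 3 * a * ((u : ℝ) - l)}) := by
        refine measure_mono fun ω hω => ?_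
        simp only [Set.mem_ofPred_eq, not_forall, not_lt] at hω
        obtain ⟨h, hh, hle⟩ := hω
        obtain ⟨h', hh', hball⟩ := Set.mem_iUnion₂.mp (hTcov (mem_sphere_zero_iff_norm.mpr hh))
        rw [mem_ball_iff_norm'] at hball
        refine Set.mem_iUnion₂.mpr ⟨h', hTfin.mem_toFinset.mpr hh', ?_⟩
        have h1 := excessLoss_sub_le hτ (fun i => ε i ω) hlu.le hx h' h
        have h2 := mul_le_mul_of_nonneg_left hball.le hN.le
        have h3 := mul_le_mul_of_nonneg_right hq hr.le
        have h4 : κ * m₀ / 4 * ((u : ℝ) - l) * r = 2 * a * ((u : ℝ) - l) := by rw [ha]; ring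
        simp only [Set.mem_ofPred_eq]
        linarith
    _ ≤ ∑ h ∈ hTfin.toFinset, ENNReal.ofReal (r ^ 2 / a ^ 2 / ((u : ℝ) - l)) :=
        (measure_biUnion_finset_le _ _).trans
          (Finset.sum_le_sum fun h hh => hpoint h (hTfin.mem_toFinset.mp hh))
    _ = ENNReal.ofReal (hTfin.toFinset.card * (r ^ 2 / a ^ 2) / ((u : ℝ) - l)) := by
        rw [Finset.sum_const, nsmul_eq_mul, mul_div_assoc, ENNReal.ofReal_mul (by positivity),
          ENNReal.ofReal_natCast]

/-! ### Change locations and deterministic detection. -/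

/-- If the deviation exceeds `w`, then some location has no element of `A` within distance `w`. -/
theorem exists_forall_lt_of_not_setDev_le {A : Finset ℕ} {K : ℕ} {t : ℕ → ℕ} {w : ℝ}
    (h : ¬ setDev A (locations K t) ≤ ENNReal.ofReal w) :
    ∃ k ∈ Finset.Icc 1 K, ∀ a ∈ A, w < |(a : ℝ) - t k| := by
  by_contra! hcon
  refine h (iSup₂_le fun b hb => ?_)
  obtain ⟨k, hk, rfl⟩ := Finset.mem_image.mp hb
  obtain ⟨a, ha, hle⟩ := hcon k hk
  exact (iInf₂_le a ha).trans (ENNReal.ofReal_le_ofReal hle)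

/-- A change at `l` itself is allowed, as it compares with `l - 1`, outside the block. -/
theorem eq_of_forall_notMem_changeSet {p n : ℕ} {b : ℕ → Vec p} {l u : ℕ} (hl : 1 ≤ l)
    (hu : u ≤ n + 1) (h : ∀ i, l < i → i < u → i ∉ changeSet n b) :
    ∀ i ∈ Finset.Ico l u, b i = b l := by
  intro i hi
  obtain ⟨hli, hiu⟩ := Finset.mem_Ico.mp hi
  clear hi
  induction i, hli using Nat.le_induction with
  | base => rfl
  | succ i hli ih =>
    have h1 := h (i + 1) (by omega) hiu
    rw [changeSet, Finset.mem_filter, Finset.mem_Icc, not_and, not_not] at h1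
    rw [h1 (by omega), Nat.add_sub_cancel]
    exact ih (by omega)

theorem le_sub_of_le_minGap {K : ℕ} {t : ℕ → ℕ} {w : ℝ} (h : w ≤ minGap K t) {k : ℕ}
    (hk : k ≤ K) : w ≤ (t (k + 1) : ℝ) - t k :=
  h.trans (Finset.inf'_le _ (Finset.mem_range.mpr (by omega)))

theorem HasPhases.one_le {p n K : ℕ} {t : ℕ → ℕ} {φ b : ℕ → Vec p} (h : HasPhases n K t φ b)
    {k : ℕ} (hk : k ≤ K + 1) : 1 ≤ t k := by
  induction k with
  | zero => exact h.first.ge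
  | succ k ih => exact (ih (by omega)).trans (h.lt k (by omega)).le

theorem HasPhases.le {p n K : ℕ} {t : ℕ → ℕ} {φ b : ℕ → Vec p} (h : HasPhases n K t φ b)
    {k : ℕ} (hk : k ≤ K + 1) : t k ≤ n := by
  obtain ⟨d, hd⟩ := Nat.exists_eq_add_of_le hk
  induction d generalizing k with
  | zero =>
    obtain rfl : k = K + 1 := by omega
    exact h.last.le
  | succ d ih => exact (h.lt k (by omega)).le.trans (ih (by omega) (by omega))

/-- A minimizer has a change location near every change-point, provided that the excess loss is
large around zero on the blocks of length `m` to the left and to the right of the change-points. -/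
theorem setDev_le_of_isMin {p n K m : ℕ} {τ lam w r : ℝ} (hlam : 0 ≤ lam) {x : ℕ → Vec p}
    {t : ℕ → ℕ} {φ β : ℕ → Vec p} {e : ℕ → ℝ} {b : ℕ → Vec p} (hph : HasPhases n K t φ β)
    (hm : 0 < m) (hmw : (m : ℝ) < w + 1) (hgap : ∀ k ≤ K, m ≤ t (k + 1) - t k)
    (hmin : ∀ b', objective n τ lam x (fun i => inner ℝ (x i) (β i) + e i) b ≤
      objective n τ lam x (fun i => inner ℝ (x i) (β i) + e i) b') (hr : 0 < r)
    (hjump : ∀ k ∈ Finset.Icc 1 K, 2 * r ≤ ‖φ (k + 1) - φ k‖)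
    (hleft : ∀ k ∈ Finset.Icc 1 K, ∀ h : Vec p, ‖h‖ = r →
      2 * (n * lam) * r < excessLoss τ x e (t k - m) (t k) h)
    (hright : ∀ k ∈ Finset.Icc 1 K, ∀ h : Vec p, ‖h‖ = r →
      2 * (n * lam) * r < excessLoss τ x e (t k) (t k + m) h) :
    setDev (changeSet n b) (locations K t) ≤ ENNReal.ofReal w := by
  by_contra hdev
  obtain ⟨k, hk, hfar⟩ := exists_forall_lt_of_not_setDev_le hdev
  obtain ⟨hk1, hkK⟩ := Finset.mem_Icc.mp hk
  obtain ⟨j, rfl⟩ : ∃ j, k = j + 1 := ⟨k - 1, by omega⟩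
  have hg1 := hgap j (by omega)
  have hg2 := hgap (j + 1) hkK
  have ht0 := hph.one_le (k := j) (by omega)
  have ht2 := hph.le (k := j + 1 + 1) (by omega)
  have hlt1 := hph.lt j (by omega)
  have hlt2 := hph.lt (j + 1) hkK
  -- Interior indices are within `m - 1 < w` of the change-point, so rounding up to `m` is harmless.
  have hconst := eq_of_forall_notMem_changeSet (n := n) (b := b) (l := t (j + 1) - m)
    (u := t (j + 1) + m) (by omega) (by omega) fun i hi1 hi2 hi => by
      have h1 := hfar i hi
      have h2 : (i : ℝ) + 1 ≤ t (j + 1) + m := by exact_mod_cast hi2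
      have h3 : (t (j + 1) : ℝ) + 1 ≤ i + m := by
        have : t (j + 1) + 1 ≤ i + m := by omega
        exact_mod_cast this
      have h4 : |(i : ℝ) - t (j + 1)| ≤ m - 1 := abs_le.mpr ⟨by linarith, by linarith⟩
      linarith
  have hL := norm_sub_lt_of_isMin hlam hmin (l := t (j + 1) - m) (u := t (j + 1)) (φ := φ (j + 1))
    (c := b (t (j + 1) - m)) (by omega) (by omega)
    (fun i hi => by
      rw [Finset.mem_Ico] at hi
      exact hph.eq_phase j (by omega) i (by omega) (by omega))
    (fun i hi => hconst i (by rw [Finset.mem_Ico] at hi ⊢; omega)) hr (hleft _ hk)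
  have hR := norm_sub_lt_of_isMin hlam hmin (l := t (j + 1)) (u := t (j + 1) + m)
    (φ := φ (j + 1 + 1)) (c := b (t (j + 1) - m)) (by omega) (by omega)
    (fun i hi => by
      rw [Finset.mem_Ico] at hi
      exact hph.eq_phase (j + 1) hkK i (by omega) (by omega))
    (fun i hi => hconst i (by rw [Finset.mem_Ico] at hi ⊢; omega)) hr (hright _ hk)
  have hj := hjump _ hk
  rw [norm_sub_rev] at hR
  have htri := norm_add_le (φ (j + 1 + 1) - b (t (j + 1) - m)) (b (t (j + 1) - m) - φ (j + 1))
  rw [sub_add_sub_cancel] at htri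
  linarith

/-! ### Asymptotics. -/

theorem GapCondition.tendsto_mul_atTop {K : ℕ} {t : ℕ → ℕ → ℕ} {δ : ℕ → ℝ}
    (h : GapCondition K t δ) : Tendsto (fun n : ℕ => n * δ n) atTop atTop := by
  have hlog : Tendsto (fun n : ℕ => Real.log n) atTop atTop :=
    Real.tendsto_log_atTop.comp tendsto_natCast_atTop_atTop
  refine (h.tendsto_log.atTop_mul_atTop₀ hlog).congr' ?_
  filter_upwards [hlog.eventually_gt_atTop 0] with n hn
  exact div_mul_cancel₀ _ hn.ne'

/-- Every change-point is detected up to the distance `n δ_n` with probability tending to one. -/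
theorem tendsto_measure_not_setDev_le {Ω : Type*} [MeasurableSpace Ω] (P : Measure Ω)
    [IsProbabilityMeasure P] (p : ℕ) (τ : ℝ) (hτ : 0 < τ ∧ τ < 1) (K : ℕ)
    (ν : Measure ℝ) (ε : ℕ → Ω → ℝ) (x : ℕ → ℕ → Vec p)
    (t : ℕ → ℕ → ℕ) (φ : ℕ → ℕ → Vec p) (β : ℕ → ℕ → Vec p)
    (Y : ℕ → ℕ → Ω → ℝ) (lam δ : ℕ → ℝ) (bhat : ℕ → Ω → ℕ → Vec p)
    (hphases : ∀ᶠ n : ℕ in atTop, HasPhases n K (t n) (φ n) (β n))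
    (hY : ∀ n i ω, Y n i ω = inner ℝ (x n i) (β n i) + ε i ω)
    (hdesign : BoundedDesign x) (herrors : ErrorModel P ν τ ε) (heigen : DesignEigenvalues δ x)
    (hgap : GapCondition K t δ) (hjumps : JumpSizes K φ) (htuning : TuningCondition lam δ)
    (hbhat : IsFusedEstimator P τ lam x Y bhat) :
    Tendsto (fun n : ℕ => P {ω | ¬ setDev (changeSet n (bhat n ω)) (locations K (t n)) ≤
      ENNReal.ofReal (n * δ n)}) atTop (𝓝 0) := by
  obtain ⟨c₁, -, hc₁, hx⟩ := hdesign
  obtain ⟨m₀, M₀, hm₀, -, heig⟩ := heigen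
  obtain ⟨ca, cb, -, hcb, hjump⟩ := hjumps
  -- Radius `cb / 2`: two such errors cannot bridge a jump larger than `cb`.
  obtain ⟨c, C, hc, hprob⟩ := herrors.exists_measure_excessLoss_le hτ p hm₀ (half_pos hcb)
  have hw := hgap.tendsto_mul_atTop
  have hceil : Tendsto (fun n : ℕ => ((⌈n * δ n⌉₊ : ℕ) : ℝ)) atTop atTop :=
    tendsto_atTop_mono (fun n => Nat.le_ceil _) hw
  have hbound : Tendsto (fun n : ℕ => (K : ℝ≥0∞) *
      (2 * ENNReal.ofReal (C / (⌈n * δ n⌉₊ : ℕ)))) atTop (𝓝 0) := by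
    have h1 : Tendsto (fun n : ℕ => ENNReal.ofReal (C / (⌈n * δ n⌉₊ : ℕ))) atTop (𝓝 0) := by
      have := ENNReal.tendsto_ofReal (hceil.const_div_atTop C)
      rwa [ENNReal.ofReal_zero] at this
    have h2 := ENNReal.Tendsto.const_mul (a := (K : ℝ≥0∞))
      (ENNReal.Tendsto.const_mul (a := 2) h1 (Or.inr (by simp))) (Or.inr (by simp))
    simpa using h2
  refine tendsto_of_tendsto_of_tendsto_of_le_of_le' tendsto_const_nhds hbound
    (Eventually.of_forall fun _ => zero_le) ?_
  filter_upwards [hphases, heig, hjump, hgap.le_minGap, hw.eventually_gt_atTop 0,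
    htuning.tendsto_ratio.eventually_le_const (half_pos hc)] with n hph hei hju hga hwn hra
  -- Rounding up makes the blocks long enough for the eigenvalue bound; they still fit in the phases
  -- because the gaps are integers.
  set m : ℕ := ⌈n * δ n⌉₊ with hm
  have hm0 : 0 < m := Nat.ceil_pos.mpr hwn
  have hmw : (m : ℝ) < n * δ n + 1 := Nat.ceil_lt_add_one hwn.le
  have hwm : n * δ n ≤ (m : ℝ) := Nat.le_ceil _
  have hgm : ∀ k ≤ K, m ≤ t n (k + 1) - t n k := fun k hk => by
    rw [hm, Nat.ceil_le, Nat.cast_sub (hph.lt k hk).le]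
    exact le_sub_of_le_minGap hga hk
  -- Eventually `λ_n / δ_n ≤ c / 2`, so the penalty is below the curvature of the loss.
  have hq : 2 * (n * lam n) ≤ c * (m : ℝ) := by
    rw [div_le_iff₀ (hgap.pos n)] at hra
    have h1 := mul_le_mul_of_nonneg_left hra (Nat.cast_nonneg (α := ℝ) n)
    have h2 := mul_le_mul_of_nonneg_left hwm hc.le
    linarith
  have hblock : ∀ l u : ℕ, 1 ≤ l → u ≤ n → (u : ℝ) - l = m →
      P {ω | ¬ ∀ h : Vec p, ‖h‖ = cb / 2 →
        2 * (n * lam n) * (cb / 2) < excessLoss τ (x n) (fun i => ε i ω) l u h} ≤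
      ENNReal.ofReal (C / m) := by
    intro l u hl hu hlu
    have hlt : l < u := by
      have : (0 : ℝ) < (u : ℝ) - l := by rw [hlu]; exact_mod_cast hm0
      exact_mod_cast sub_pos.mp this
    rw [← hlu]
    refine hprob (x n) l u _ hlt (fun i hi => ?_)
      (mul_sq_norm_le_sum_inner_sq hlt (hei l u hl hlt hu (by rwa [hlu]))) (by rwa [hlu])
    rw [Finset.mem_Ico] at hi
    exact (hx n i (Finset.mem_Icc.mpr ⟨by omega, by omega⟩)).trans hc₁.le
  set B : ℕ → ℕ → Set Ω := fun l u => {ω | ¬ ∀ h : Vec p, ‖h‖ = cb / 2 →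
        2 * (n * lam n) * (cb / 2) < excessLoss τ (x n) (fun i => ε i ω) l u h} with hB
  calc P {ω | ¬ setDev (changeSet n (bhat n ω)) (locations K (t n)) ≤ ENNReal.ofReal (n * δ n)}
      ≤ P (⋃ k ∈ Finset.Icc 1 K, (B (t n k - m) (t n k) ∪ B (t n k) (t n k + m))) := by
        refine measure_mono_ae ?_
        filter_upwards [hbhat.isMin n] with ω hmin hdev
        by_contra hgood
        refine hdev ?_
        have hgood' : ∀ k ∈ Finset.Icc 1 K,
            ω ∉ B (t n k - m) (t n k) ∧ ω ∉ B (t n k) (t n k + m) := by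
          intro k hk
          rw [← not_or]
          exact fun h => hgood (Set.mem_iUnion₂.mpr ⟨k, hk, h⟩)
        simp only [hY] at hmin
        refine setDev_le_of_isMin (htuning.pos n).le hph hm0 hmw hgm hmin (half_pos hcb)
          (fun k hk => ?_) (fun k hk => not_not.mp (hgood' k hk).1)
          (fun k hk => not_not.mp (hgood' k hk).2)
        linarith [(hju k hk).2]
    _ ≤ ∑ k ∈ Finset.Icc 1 K, 2 * ENNReal.ofReal (C / m) := by
        refine (measure_biUnion_finset_le _ _).trans (Finset.sum_le_sum fun k hk => ?_)
        obtain ⟨hk1, hkK⟩ := Finset.mem_Icc.mp hk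
        obtain ⟨j, rfl⟩ : ∃ j, k = j + 1 := ⟨k - 1, by omega⟩
        have hg1 := hgm j (by omega)
        have hg2 := hgm (j + 1) hkK
        have ht0 := hph.one_le (k := j) (by omega)
        have ht2 := hph.le (k := j + 1 + 1) (by omega)
        have hlt1 := hph.lt j (by omega)
        have hlt2 := hph.lt (j + 1) hkK
        refine (measure_union_le _ _).trans ?_
        rw [two_mul]
        refine add_le_add (hblock _ _ (by omega) (by omega) ?_)
          (hblock _ _ (by omega) (by omega) ?_)
        · rw [Nat.cast_sub (by omega)]; ring
        · push_cast; ring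
    _ = (K : ℝ≥0∞) * (2 * ENNReal.ofReal (C / m)) := by
        rw [Finset.sum_const, Nat.card_Icc, Nat.add_sub_cancel, nsmul_eq_mul]

end QuantileFused

theorem theorem3p2 {Ω : Type*} [MeasurableSpace Ω] (P : Measure Ω) [IsProbabilityMeasure P]
    (p : ℕ) [NeZero p] (τ : ℝ) (hτ : 0 < τ ∧ τ < 1) (K Kmax : ℕ)
    (ν : Measure ℝ) (ε : ℕ → Ω → ℝ) (x : ℕ → ℕ → QuantileFused.Vec p)
    (t : ℕ → ℕ → ℕ) (φ : ℕ → ℕ → QuantileFused.Vec p) (β : ℕ → ℕ → QuantileFused.Vec p)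
    (Y : ℕ → ℕ → Ω → ℝ) (lam δ : ℕ → ℝ) (bhat : ℕ → Ω → ℕ → QuantileFused.Vec p)
    (hphases : ∀ᶠ n : ℕ in atTop, QuantileFused.HasPhases n K (t n) (φ n) (β n))
    (hY : ∀ n i ω, Y n i ω = inner ℝ (x n i) (β n i) + ε i ω)
    (hintercept : QuantileFused.HasIntercept x)
    (hdesign : QuantileFused.BoundedDesign x)
    (herrors : QuantileFused.ErrorModel P ν τ ε)
    (heigen : QuantileFused.DesignEigenvalues δ x)
    (hgap : QuantileFused.GapCondition K t δ)
    (hjumps : QuantileFused.JumpSizes K φ)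
    (htuning : QuantileFused.TuningCondition lam δ)
    (hident : QuantileFused.Identifiable K ν τ δ x t φ)
    (hbhat : QuantileFused.IsFusedEstimator P τ lam x Y bhat) :
    Tendsto (fun n : ℕ => P {ω |
        (K ≤ (QuantileFused.changeSet n (bhat n ω)).card ∧
          (QuantileFused.changeSet n (bhat n ω)).card ≤ Kmax) ∧
        ¬ QuantileFused.setDev (QuantileFused.changeSet n (bhat n ω))
            (QuantileFused.locations K (t n)) ≤ ENNReal.ofReal (n * δ n)}) atTop (𝓝 0) ∧
    (Tendsto (fun n : ℕ => P {ω |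
        K ≤ (QuantileFused.changeSet n (bhat n ω)).card ∧
          (QuantileFused.changeSet n (bhat n ω)).card ≤ Kmax}) atTop (𝓝 1) →
      Tendsto (fun n : ℕ => P {ω |
        QuantileFused.setDev (QuantileFused.changeSet n (bhat n ω))
            (QuantileFused.locations K (t n)) ≤ ENNReal.ofReal (n * δ n)}) atTop (𝓝 1)) := by
  have hmiss := QuantileFused.tendsto_measure_not_setDev_le P p τ hτ K ν ε x t φ β Y lam δ bhat
    hphases hY hdesign herrors heigen hgap hjumps htuning hbhat
  refine ⟨tendsto_of_tendsto_of_tendsto_of_le_of_le tendsto_const_nhds hmiss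
    (fun _ => zero_le) fun n => measure_mono fun ω hω => hω.2, fun hcard => ?_⟩
  -- The cardinality event is covered by success and miss, so success has at least the difference of
  -- the two probabilities; subadditivity needs no measurability.
  have hlow := ENNReal.Tendsto.sub hcard hmiss (Or.inl (by simp))
  rw [tsub_zero] at hlow
  refine tendsto_of_tendsto_of_tendsto_of_le_of_le hlow tendsto_const_nhds (fun n => ?_)
    fun n => prob_le_one
  refine tsub_le_iff_right.mpr ((measure_mono fun ω _ => ?_).trans (measure_union_le _ _))
  exact em _
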